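/- Let $1\le p<\infty$. Let $H^p(\mathbb{D})$ be the space of all holomorphic functions $f$ on the open unit disk $\mathbb{D}$ with $$\|f\|_p=\Bigl(\sup_{0<r<1}\frac1{2\pi}\int_0^{2\pi}|f(re^{i\theta})|^p\,d\theta\Bigr)^{1/p}<\infty ,$$ normed by $\|\cdot\|_p$. A bounded operator $T$ on a complex normed space $X$ has the positive shadowing property if for every $\varepsilon>0$ there is $\delta>0$ such that for every sequence $(x_n)_{n\ge1}$ in $X$ with $\|Tx_n-x_{n+1}\|\le\delta$ for all $n\ge1$ there exists $x\in X$ with $\|T^nx-x_n\|\le\varepsilon$ for all $n\ge1$. Let $\phi(z)=\frac{az+b}{cz+d}$, with $a,b,c,d\in\mathbb{C}$ and $ad-bc\ne0$, be a linear fractional map with $\phi(\mathbb{D})\subset\mathbb{D}$ that is parabolic, i.e. has exactly one fixed point in the Riemann sphere $\mathbb{C}\cup\{\infty\}$. Then the composition operator $C_\phi f=f\circ\phi$ is a bounded operator on $H^p(\mathbb{D})$, and it does not have the positive shadowing property. -/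

import Mathlib

open scoped Complex.UnitDisc

noncomputable section

namespace HardyShadowing

/-- Extension by `0` of a function on the open unit disc to the whole plane. -/
def ext (f : 𝔻 → ℂ) : ℂ → ℂ := Function.extend (fun z : 𝔻 => (z : ℂ)) f 0

/-- `f` is holomorphic on the open unit disc. -/
def IsHol (f : 𝔻 → ℂ) : Prop := DifferentiableOn ℂ (ext f) (Metric.ball 0 1)

/-- The integral mean `(1 / 2π) ∫₀^{2π} |f (r e^{iθ})|^p dθ`. -/
def mean (p : ℝ) (f : 𝔻 → ℂ) (r : ℝ) : ℝ :=
  Real.circleAverage (fun z => ‖ext f z‖ ^ p) 0 r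

/-- `‖f‖_p = (sup_{0 < r < 1} (1 / 2π) ∫₀^{2π} |f (r e^{iθ})|^p dθ)^{1/p}`. -/
def hpNorm (p : ℝ) (f : 𝔻 → ℂ) : ℝ :=
  (⨆ r : Set.Ioo (0 : ℝ) 1, mean p f r) ^ (1 / p)

/-- `f` belongs to the Hardy space: it is holomorphic and its integral means are bounded. -/
def MemHp (p : ℝ) (f : 𝔻 → ℂ) : Prop :=
  IsHol f ∧ BddAbove (Set.range fun r : Set.Ioo (0 : ℝ) 1 => mean p f r)

theorem ext_coe (f : 𝔻 → ℂ) (z : 𝔻) : ext f z = f z :=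
  Complex.UnitDisc.coe_injective.extend_apply f 0 z

theorem ext_zero : ext 0 = 0 := Function.extend_zero _

theorem ext_add (f g : 𝔻 → ℂ) : ext (f + g) = ext f + ext g := by
  simpa [ext] using Function.extend_add (fun z : 𝔻 => (z : ℂ)) f g 0 0

theorem ext_smul (c : ℂ) (f : 𝔻 → ℂ) : ext (c • f) = c • ext f := by
  simpa [ext] using Function.extend_smul c (fun z : 𝔻 => (z : ℂ)) f 0

theorem mean_nonneg (p : ℝ) (f : 𝔻 → ℂ) (r : ℝ) : 0 ≤ mean p f r := by
  unfold mean Real.circleAverage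
  refine smul_nonneg (by positivity) ?_
  exact intervalIntegral.integral_nonneg (by positivity) (fun θ _ => by positivity)

theorem IsHol.continuous_circle {f : 𝔻 → ℂ} (hf : IsHol f) {r : ℝ} (hr : r ∈ Set.Ioo (0 : ℝ) 1) :
    Continuous fun θ : ℝ => ext f (circleMap 0 r θ) := by
  refine hf.continuousOn.comp_continuous (continuous_circleMap 0 r) fun θ => ?_
  simp [abs_of_pos hr.1, hr.2]

/-- Minkowski's inequality on a circle. -/
theorem mean_add_le {p : ℝ} (hp : 1 ≤ p) {f g : 𝔻 → ℂ} (hf : IsHol f) (hg : IsHol g) {r : ℝ}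
    (hr : r ∈ Set.Ioo (0 : ℝ) 1) :
    mean p (f + g) r ^ (1 / p) ≤ mean p f r ^ (1 / p) + mean p g r ^ (1 / p) := by
  have hp0 : 0 < p := by linarith
  set μ := (MeasureTheory.volume : MeasureTheory.Measure ℝ).restrict
    (Set.Ioc 0 (2 * Real.pi)) with hμ
  have key : ∀ u : ℝ → ℂ, Continuous u → MeasureTheory.MemLp u (ENNReal.ofReal p) μ := by
    intro u hu
    obtain ⟨C, hC⟩ := (isCompact_Icc (a := (0 : ℝ)) (b := 2 * Real.pi)).exists_bound_of_continuousOn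
      hu.continuousOn
    refine MeasureTheory.MemLp.of_bound hu.aestronglyMeasurable C ?_
    refine (MeasureTheory.ae_restrict_iff' measurableSet_Ioc).2 (Filter.Eventually.of_forall ?_)
    exact fun x hx => hC x ⟨hx.1.le, hx.2⟩
  have eq1 : ∀ u : ℝ → ℂ, Continuous u → (MeasureTheory.eLpNorm u (ENNReal.ofReal p) μ).toReal
      = (∫ θ in (0 : ℝ)..2 * Real.pi, ‖u θ‖ ^ p) ^ (1 / p) := by
    intro u hu
    rw [(key u hu).eLpNorm_eq_integral_rpow_norm (by simpa using hp0) ENNReal.ofReal_ne_top,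
      ENNReal.toReal_ofReal (by positivity), ENNReal.toReal_ofReal hp0.le,
      intervalIntegral.integral_of_le (by positivity), one_div]
  have hfc := hf.continuous_circle hr
  have hgc := hg.continuous_circle hr
  have mk := MeasureTheory.eLpNorm_add_le (p := ENNReal.ofReal p) (key _ hfc).1 (key _ hgc).1
    (by simpa using hp)
  have mk2 := ENNReal.toReal_mono (ENNReal.add_ne_top.2 ⟨(key _ hfc).2.ne, (key _ hgc).2.ne⟩) mk
  rw [ENNReal.toReal_add (key _ hfc).2.ne (key _ hgc).2.ne, eq1 _ hfc, eq1 _ hgc,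
    eq1 _ (hfc.add hgc)] at mk2
  have split : ∀ h : 𝔻 → ℂ, mean p h r ^ (1 / p) = ((2 * Real.pi)⁻¹) ^ (1 / p) *
      (∫ θ in (0 : ℝ)..2 * Real.pi, ‖ext h (circleMap 0 r θ)‖ ^ p) ^ (1 / p) := by
    intro h
    rw [← Real.mul_rpow (by positivity)
      (intervalIntegral.integral_nonneg (by positivity) (fun θ _ => by positivity))]
    rfl
  rw [split, split, split, ← mul_add, ext_add]
  exact mul_le_mul_of_nonneg_left mk2 (by positivity)

theorem mean_smul {p : ℝ} (c : ℂ) (f : 𝔻 → ℂ) (r : ℝ) :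
    mean p (c • f) r = ‖c‖ ^ p * mean p f r := by
  unfold mean
  rw [ext_smul, ← smul_eq_mul, ← Real.circleAverage_fun_smul]
  congr 1
  ext z
  simp [Real.mul_rpow]

theorem hpNorm_nonneg (p : ℝ) (f : 𝔻 → ℂ) : 0 ≤ hpNorm p f :=
  Real.rpow_nonneg (Real.iSup_nonneg fun _ => mean_nonneg _ _ _) _

theorem MemHp.mean_le {p : ℝ} (hp : 1 ≤ p) {f : 𝔻 → ℂ} (hf : MemHp p f) {r : ℝ}
    (hr : r ∈ Set.Ioo (0 : ℝ) 1) : mean p f r ^ (1 / p) ≤ hpNorm p f :=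
  Real.rpow_le_rpow (mean_nonneg _ _ _) (le_ciSup hf.2 ⟨r, hr⟩) (by positivity)

theorem mean_le_of_rpow_le {p : ℝ} (hp : 1 ≤ p) {f : 𝔻 → ℂ} {r C : ℝ}
    (h : mean p f r ^ (1 / p) ≤ C) : mean p f r ≤ C ^ p := by
  have h1 := Real.rpow_le_rpow (Real.rpow_nonneg (mean_nonneg p f r) _) h (by linarith : 0 ≤ p)
  rwa [← Real.rpow_mul (mean_nonneg _ _ _), one_div_mul_cancel (by linarith), Real.rpow_one] at h1

theorem MemHp.add {p : ℝ} (hp : 1 ≤ p) {f g : 𝔻 → ℂ} (hf : MemHp p f) (hg : MemHp p g) :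
    MemHp p (f + g) := by
  refine ⟨?_, (hpNorm p f + hpNorm p g) ^ p, ?_⟩
  · unfold IsHol
    rw [ext_add]
    exact DifferentiableOn.add hf.1 hg.1
  · rintro _ ⟨r, rfl⟩
    exact mean_le_of_rpow_le hp ((mean_add_le hp hf.1 hg.1 r.2).trans
      (add_le_add (hf.mean_le hp r.2) (hg.mean_le hp r.2)))

theorem MemHp.smul {p : ℝ} (c : ℂ) {f : 𝔻 → ℂ} (hf : MemHp p f) : MemHp p (c • f) := by
  refine ⟨?_, ?_⟩
  · unfold IsHol
    rw [ext_smul]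
    exact DifferentiableOn.const_smul hf.1 c
  · obtain ⟨C, hC⟩ := hf.2
    refine ⟨‖c‖ ^ p * C, ?_⟩
    rintro _ ⟨r, rfl⟩
    simp only [mean_smul]
    exact mul_le_mul_of_nonneg_left (hC ⟨r, rfl⟩) (by positivity)

theorem mean_zero {p : ℝ} (hp : 1 ≤ p) (r : ℝ) : mean p 0 r = 0 := by
  have h := mean_smul (p := p) 0 (0 : 𝔻 → ℂ) r
  simpa [Real.zero_rpow (by linarith : p ≠ 0)] using h

theorem MemHp.zero {p : ℝ} (hp : 1 ≤ p) : MemHp p 0 := by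
  refine ⟨?_, 0, ?_⟩
  · unfold IsHol
    rw [ext_zero]
    exact differentiableOn_const 0
  · rintro _ ⟨r, rfl⟩
    exact (mean_zero hp r).le

theorem hpNorm_add_le {p : ℝ} (hp : 1 ≤ p) {f g : 𝔻 → ℂ} (hf : MemHp p f) (hg : MemHp p g) :
    hpNorm p (f + g) ≤ hpNorm p f + hpNorm p g := by
  have : Nonempty (Set.Ioo (0 : ℝ) 1) := ⟨⟨1 / 2, by norm_num, by norm_num⟩⟩
  have hC : 0 ≤ hpNorm p f + hpNorm p g := add_nonneg (hpNorm_nonneg _ _) (hpNorm_nonneg _ _)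
  have h1 : (⨆ r : Set.Ioo (0 : ℝ) 1, mean p (f + g) r) ≤ (hpNorm p f + hpNorm p g) ^ p :=
    ciSup_le fun r => mean_le_of_rpow_le hp ((mean_add_le hp hf.1 hg.1 r.2).trans
      (add_le_add (hf.mean_le hp r.2) (hg.mean_le hp r.2)))
  have h2 := Real.rpow_le_rpow (Real.iSup_nonneg fun _ => mean_nonneg _ _ _) h1
    (by positivity : 0 ≤ 1 / p)
  rwa [← Real.rpow_mul hC, mul_one_div_cancel (by linarith), Real.rpow_one] at h2

theorem hpNorm_smul {p : ℝ} (hp : 1 ≤ p) (c : ℂ) (f : 𝔻 → ℂ) :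
    hpNorm p (c • f) = ‖c‖ * hpNorm p f := by
  unfold hpNorm
  simp only [mean_smul]
  rw [← Real.mul_iSup_of_nonneg (by positivity), Real.mul_rpow (by positivity)
    (Real.iSup_nonneg fun _ => mean_nonneg _ _ _), ← Real.rpow_mul (norm_nonneg c),
    mul_one_div_cancel (by linarith), Real.rpow_one]

theorem eq_zero_of_hpNorm {p : ℝ} (hp : 1 ≤ p) {f : 𝔻 → ℂ} (hf : MemHp p f)
    (h : hpNorm p f = 0) : f = 0 := by
  have hp0 : 0 < p := by linarith
  have hm : ∀ r ∈ Set.Ioo (0 : ℝ) 1, ∀ θ, ext f (circleMap 0 r θ) = 0 := by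
    intro r hr
    have h0 : mean p f r = 0 := by
      have h1 := mean_le_of_rpow_le hp (h ▸ hf.mean_le hp hr)
      rw [Real.zero_rpow hp0.ne'] at h1
      exact le_antisymm h1 (mean_nonneg _ _ _)
    have hc : Continuous fun θ : ℝ => ‖ext f (circleMap 0 r θ)‖ ^ p :=
      (hf.1.continuous_circle hr).norm.rpow_const fun _ => Or.inr hp0.le
    have h1 : ∫ θ in (0 : ℝ)..2 * Real.pi, ‖ext f (circleMap 0 r θ)‖ ^ p = 0 := by
      have : (2 * Real.pi)⁻¹ * ∫ θ in (0 : ℝ)..2 * Real.pi, ‖ext f (circleMap 0 r θ)‖ ^ p = 0 := h0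
      exact (mul_eq_zero.1 this).resolve_left (by positivity)
    have hI : ∀ θ ∈ Set.Ico (0 : ℝ) (2 * Real.pi), ext f (circleMap 0 r θ) = 0 := by
      intro θ hθ
      by_contra hne
      have hpos := intervalIntegral.integral_pos (a := 0) (b := 2 * Real.pi) (by positivity)
        hc.continuousOn (fun x _ => by positivity)
        ⟨θ, ⟨hθ.1, hθ.2.le⟩, Real.rpow_pos_of_pos (norm_pos_iff.2 hne) p⟩
      exact hpos.ne' h1
    intro θ
    obtain ⟨y, hy, hyeq⟩ := (periodic_circleMap 0 r).exists_mem_Ico₀ Real.two_pi_pos θ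
    rw [hyeq]
    exact hI y hy
  have hz : ∀ w : ℂ, w ∈ Metric.ball (0 : ℂ) 1 → w ≠ 0 → ext f w = 0 := by
    intro w hw hw0
    have := hm ‖w‖ ⟨norm_pos_iff.2 hw0, by simpa using hw⟩ w.arg
    rwa [circleMap_zero, Complex.norm_mul_exp_arg_mul_I] at this
  have h0 : ext f 0 = 0 := by
    have hcont : ContinuousAt (ext f) 0 :=
      hf.1.continuousOn.continuousAt (Metric.ball_mem_nhds 0 one_pos)
    refine tendsto_nhds_unique (hcont.tendsto.mono_left (nhdsWithin_le_nhds (s := {0}ᶜ))) ?_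
    refine tendsto_const_nhds.congr' ?_
    filter_upwards [nhdsWithin_le_nhds (Metric.ball_mem_nhds (0 : ℂ) one_pos),
      self_mem_nhdsWithin] with w hw hw0
    exact (hz w hw hw0).symm
  funext z
  rw [← ext_coe f z]
  by_cases hz0 : (z : ℂ) = 0
  · rw [hz0, h0]; rfl
  · exact hz z (by simpa using z.norm_lt_one) hz0

/-- The Hardy space as a linear subspace of the space of functions on the disc. -/
def hpSubmodule (p : ℝ) [hp : Fact (1 ≤ p)] : Submodule ℂ (𝔻 → ℂ) where
  carrier := {f | MemHp p f}
  add_mem' hf hg := hf.add hp.out hg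
  zero_mem' := MemHp.zero hp.out
  smul_mem' c _ hf := hf.smul c

/-- The Hardy space `H^p(𝔻)`, `1 ≤ p < ∞`, with the norm `hpNorm p`. (It is a type of its own so
that it does not inherit the topology of pointwise convergence.) -/
def Hp (p : ℝ) [Fact (1 ≤ p)] : Type := hpSubmodule p

variable {p : ℝ} [hp : Fact (1 ≤ p)]

instance : AddCommGroup (Hp p) := inferInstanceAs (AddCommGroup (hpSubmodule p))

instance : Module ℂ (Hp p) := inferInstanceAs (Module ℂ (hpSubmodule p))

instance : CoeFun (Hp p) fun _ => 𝔻 → ℂ := ⟨fun f => f.1⟩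

instance : Norm (Hp p) := ⟨fun f => hpNorm p f⟩

theorem hp_core : NormedSpace.Core ℂ (Hp p) where
  norm_nonneg f := hpNorm_nonneg p f.1
  norm_smul c f := hpNorm_smul hp.out c f.1
  norm_triangle f g := hpNorm_add_le hp.out f.2 g.2
  norm_eq_zero_iff f := by
    refine ⟨fun h => Subtype.ext (eq_zero_of_hpNorm hp.out f.2 h), ?_⟩
    rintro rfl
    have h := hpNorm_smul hp.out 0 (0 : 𝔻 → ℂ)
    rw [zero_smul, norm_zero, zero_mul] at h
    exact h

instance : NormedAddCommGroup (Hp p) := NormedAddCommGroup.ofCore hp_core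

instance : NormedSpace ℂ (Hp p) := NormedSpace.ofCore hp_core

/-- `x₁, x₂, …` is a `δ`-pseudo-orbit of `T` (the value `x 0` plays no role). -/
def IsPseudoOrbit {X : Type*} [NormedAddCommGroup X] [NormedSpace ℂ X] (T : X →L[ℂ] X) (δ : ℝ)
    (x : ℕ → X) : Prop :=
  ∀ n : ℕ, 1 ≤ n → ‖T (x n) - x (n + 1)‖ ≤ δ

/-- The positive shadowing property of a bounded operator. -/
def PositiveShadowing {X : Type*} [NormedAddCommGroup X] [NormedSpace ℂ X]
    (T : X →L[ℂ] X) : Prop :=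
  ∀ ε : ℝ, 0 < ε → ∃ δ : ℝ, 0 < δ ∧ ∀ x : ℕ → X, IsPseudoOrbit T δ x →
    ∃ y : X, ∀ n : ℕ, 1 ≤ n → ‖(T ^ n) y - x n‖ ≤ ε

/-- `φ` is a parabolic linear fractional self-map of the disc: it is the restriction of a
linear fractional transformation `z ↦ (a z + b) / (c z + d)`, `a d - b c ≠ 0`, of the Riemann
sphere `ℂ ∪ {∞}` which has exactly one fixed point on the sphere. -/
def IsParabolic (φ : 𝔻 → 𝔻) : Prop :=
  ∃ g : GL (Fin 2) ℂ, (∀ z : 𝔻, ((φ z : ℂ) : OnePoint ℂ) = g • ((z : ℂ) : OnePoint ℂ)) ∧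
    ∃! w : OnePoint ℂ, g • w = w

end HardyShadowing

end

/-!
Boundedness of `C_φ` is Littlewood's subordination principle: `‖f‖ ^ p` is dominated by the Poisson
integral of its values on a circle, and that Poisson integral stays harmonic after composition
with `φ`.

Suppose that `C_φ` has the positive shadowing property. Since `C_φ 1 = 1`, the constants `n κ`
form a pseudo-orbit when `κ` is small, so some `y` in `H^p` satisfies `y ∘ φ^[n] = n κ + O(1)`,
uniformly on compact subsets of the disc. Pointwise growth alone does not exclude such a `y`,
because the orbit may approach the boundary quadratically fast, so one looks at a primitive `H`
of `y`. The fixed point `α` of `φ` is finite and lies outside the disc, and `z ↦ (z - α)⁻¹` turns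
`φ` into a translation by some `s ≠ 0`. Hence the `n`-th increment of the orbit of `0` is
`-1 / (s n ^ 2)` up to `O(1 / n ^ 3)`, and the increments of `H` along the orbit are
`-(κ / s) / n + O(1 / n ^ 2)`. Thus `H` diverges along the orbit like the harmonic series,
whereas a primitive of a function in `H^1` is bounded.
-/

namespace HardyShadowing

open Metric Real Set Filter Asymptotics Topology

section PoissonIntegral

variable {c w : ℂ} {R : ℝ} {u v : ℂ → ℝ}

theorem norm_circleAverage_le {E : Type*} [NormedAddCommGroup E] [NormedSpace ℝ E] (f : ℂ → E)
    (c : ℂ) (R : ℝ) : ‖circleAverage f c R‖ ≤ circleAverage (fun z => ‖f z‖) c R := by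
  rw [circleAverage_def, circleAverage_def, norm_smul, norm_of_nonneg (by positivity)]
  exact mul_le_mul_of_nonneg_left
    (intervalIntegral.norm_integral_le_integral_norm two_pi_pos.le) (by positivity)

theorem continuousOn_poissonKernel (hw : w ∈ ball c R) :
    ContinuousOn (poissonKernel c w) (sphere c R) := by
  rw [poissonKernel_eq_re_herglotzRieszKernel]
  simpa only [abs_of_pos (pos_of_mem_ball hw)] using
    Complex.continuous_re.comp_continuousOn (continuousOn_herglotzRieszKernel_sphere hw)

theorem poissonKernel_nonneg {z : ℂ} (hw : w ∈ ball c R) (hz : z ∈ sphere c R) :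
    0 ≤ poissonKernel c w z := by
  have hwz : ‖w - c‖ ≤ ‖z - c‖ := by
    rw [mem_sphere_iff_norm.1 hz]
    exact (mem_ball_iff_norm.1 hw).le
  rw [poissonKernel_def]
  exact div_nonneg (sub_nonneg.2 (pow_le_pow_left₀ (norm_nonneg _) hwz 2)) (by positivity)

theorem poissonKernel_le {z : ℂ} (hw : w ∈ ball c R) (hz : z ∈ sphere c R) :
    poissonKernel c w z ≤ (R + ‖w - c‖) / (R - ‖w - c‖) := by
  rw [poissonKernel_eq_re_herglotzRieszKernel]
  exact re_herglotzRieszKernel_le hz hw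

theorem circleAverage_poissonKernel (hw : w ∈ ball c R) :
    circleAverage (poissonKernel c w) c R = 1 := by
  have h : circleAverage (poissonKernel c w • (1 : ℂ → ℝ)) c R = 1 :=
    InnerProductSpace.HarmonicContOnCl.circleAverage_poissonKernel_smul
      (InnerProductSpace.harmonicContOnCl_const (c := 1)) hw
  rwa [smul_eq_mul, mul_one] at h

/-- The Poisson integral at `w` of the boundary values `u` on the circle of centre `c` and
radius `R`. -/
noncomputable def poissonIntegral (u : ℂ → ℝ) (c : ℂ) (R : ℝ) (w : ℂ) : ℝ :=
  circleAverage (fun z => poissonKernel c w z * u z) c R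

theorem circleIntegrable_poissonKernel_mul (hw : w ∈ ball c R)
    (hu : ContinuousOn u (sphere c R)) :
    CircleIntegrable (fun z => poissonKernel c w z * u z) c R :=
  ((continuousOn_poissonKernel hw).mul hu).circleIntegrable (pos_of_mem_ball hw).le

theorem poissonIntegral_mono (hw : w ∈ ball c R) (hu : ContinuousOn u (sphere c R))
    (hv : ContinuousOn v (sphere c R)) (huv : ∀ z ∈ sphere c R, u z ≤ v z) :
    poissonIntegral u c R w ≤ poissonIntegral v c R w := by
  refine circleAverage_mono (circleIntegrable_poissonKernel_mul hw hu)
    (circleIntegrable_poissonKernel_mul hw hv) fun z hz => ?_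
  rw [abs_of_pos (pos_of_mem_ball hw)] at hz
  exact mul_le_mul_of_nonneg_left (huv z hz) (poissonKernel_nonneg hw hz)

theorem poissonIntegral_const_mul (a : ℝ) :
    poissonIntegral (fun z => a * u z) c R w = a * poissonIntegral u c R w := by
  rw [poissonIntegral, poissonIntegral, ← smul_eq_mul a, ← circleAverage_fun_smul]
  simp only [smul_eq_mul, mul_left_comm]

theorem poissonIntegral_const_add (hw : w ∈ ball c R) (hu : ContinuousOn u (sphere c R)) (a : ℝ) :
    poissonIntegral (fun z => a + u z) c R w = a + poissonIntegral u c R w := by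
  have hKernel : CircleIntegrable (fun z => poissonKernel c w z * a) c R :=
    circleIntegrable_poissonKernel_mul hw continuousOn_const
  have hone : circleAverage (fun z => poissonKernel c w z * a) c R = a := by
    simp only [mul_comm _ a, ← smul_eq_mul a]
    rw [circleAverage_fun_smul, circleAverage_poissonKernel hw, smul_eq_mul, mul_one]
  simp only [poissonIntegral, mul_add]
  rw [circleAverage_fun_add hKernel (circleIntegrable_poissonKernel_mul hw hu), hone]

theorem poissonIntegral_le_mul_circleAverage (hw : w ∈ ball c R)
    (hu : ContinuousOn u (sphere c R)) (hu0 : ∀ z ∈ sphere c R, 0 ≤ u z) :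
    poissonIntegral u c R w ≤ (R + ‖w - c‖) / (R - ‖w - c‖) * circleAverage u c R := by
  have hR := pos_of_mem_ball hw
  rw [← smul_eq_mul, ← circleAverage_smul]
  refine circleAverage_mono (circleIntegrable_poissonKernel_mul hw hu)
    ((hu.const_smul _).circleIntegrable hR.le) fun z hz => ?_
  rw [abs_of_pos hR] at hz
  exact mul_le_mul_of_nonneg_right (poissonKernel_le hw hz) (hu0 z hz)

theorem mul_rpow_sub_one_mul_le {p s t : ℝ} (hp : 1 ≤ p) (hs : 0 ≤ s) (ht : 0 ≤ t) :
    p * s ^ (p - 1) * t ≤ (p - 1) * s ^ p + t ^ p := by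
  have hp0 : 0 < p := by linarith
  have h := geom_mean_le_arith_mean2_weighted (w₁ := (p - 1) / p) (w₂ := 1 / p)
    (div_nonneg (by linarith) hp0.le) (by positivity) (rpow_nonneg hs p) (rpow_nonneg ht p)
    (by field_simp; ring)
  rw [← rpow_mul hs, ← rpow_mul ht, mul_div_cancel₀ _ hp0.ne', mul_one_div_cancel hp0.ne',
    rpow_one] at h
  calc p * s ^ (p - 1) * t = p * (s ^ (p - 1) * t) := by ring
    _ ≤ p * ((p - 1) / p * s ^ p + 1 / p * t ^ p) := by gcongr
    _ = (p - 1) * s ^ p + t ^ p := by field_simp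

variable {E : Type*} [NormedAddCommGroup E] [NormedSpace ℂ E] [CompleteSpace E] {F : ℂ → E}

theorem norm_le_poissonIntegral (hF : DiffContOnCl ℂ F (ball c R)) (hw : w ∈ ball c R) :
    ‖F w‖ ≤ poissonIntegral (fun z => ‖F z‖) c R w := by
  rw [← hF.circleAverage_poissonKernel_smul hw]
  refine (norm_circleAverage_le _ _ _).trans_eq (circleAverage_congr_sphere fun z hz => ?_)
  rw [abs_of_pos (pos_of_mem_ball hw)] at hz
  simp only [Pi.smul_apply', norm_smul, norm_of_nonneg (poissonKernel_nonneg hw hz)]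

theorem norm_rpow_le_poissonIntegral {p : ℝ} (hp : 1 ≤ p) (hF : DiffContOnCl ℂ F (ball c R))
    (hw : w ∈ ball c R) : ‖F w‖ ^ p ≤ poissonIntegral (fun z => ‖F z‖ ^ p) c R w := by
  have hNorm : ContinuousOn (fun z => ‖F z‖) (sphere c R) :=
    (hF.continuousOn_ball.mono sphere_subset_closedBall).norm
  have hPow : ContinuousOn (fun z => ‖F z‖ ^ p) (sphere c R) :=
    hNorm.rpow_const fun _ _ => Or.inr (by linarith)
  have htangent := poissonIntegral_mono hw (hNorm.const_mul (p * ‖F w‖ ^ (p - 1)))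
    (hPow.const_add ((p - 1) * ‖F w‖ ^ p))
    fun z _ => mul_rpow_sub_one_mul_le hp (norm_nonneg _) (norm_nonneg (F z))
  rw [poissonIntegral_const_mul, poissonIntegral_const_add hw hPow] at htangent
  have hmean := mul_le_mul_of_nonneg_left (norm_le_poissonIntegral hF hw)
    (by positivity : 0 ≤ p * ‖F w‖ ^ (p - 1))
  have hpow : ‖F w‖ ^ p = ‖F w‖ ^ (p - 1) * ‖F w‖ := by
    rw [← rpow_add_one' (norm_nonneg _) (by linarith), sub_add_cancel]
  linear_combination htangent + hmean + p * hpow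

end PoissonIntegral

section Subordination

variable {u : ℂ → ℝ} {r R : ℝ}

theorem exists_differentiableOn_re_eq_poissonIntegral (hu : CircleIntegrable u 0 R) :
    ∃ V : ℂ → ℂ, DifferentiableOn ℂ V (ball 0 R) ∧
      EqOn (fun w => (V w).re) (poissonIntegral u 0 R) (ball 0 R) := by
  refine ⟨fun w => circleAverage (fun z => herglotzRieszKernel 0 w z • (u z : ℂ)) 0 R,
    differentiableOn_circleAverage_herglotzRieszKernel_smul ?_, fun w hw => ?_⟩
  · rw [CircleIntegrable, intervalIntegrable_iff] at hu ⊢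
    exact Complex.ofRealCLM.integrable_comp hu
  · simp only [poissonIntegral, poissonKernel_eq_re_herglotzRieszKernel]
    exact re_circleAverage_herglotzRieszKernel_smul hu hw

theorem continuousOn_poissonIntegral (hu : CircleIntegrable u 0 R) :
    ContinuousOn (poissonIntegral u 0 R) (ball 0 R) := by
  obtain ⟨V, hV, hre⟩ := exists_differentiableOn_re_eq_poissonIntegral hu
  exact (Complex.continuous_re.comp_continuousOn hV.continuousOn).congr hre.symm

variable {ψ : ℂ → ℂ}

theorem circleAverage_poissonIntegral_comp (hr : 0 ≤ r) (hu : CircleIntegrable u 0 R)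
    (hψ : DifferentiableOn ℂ ψ (closedBall 0 r)) (hmap : MapsTo ψ (closedBall 0 r) (ball 0 R)) :
    circleAverage (fun z => poissonIntegral u 0 R (ψ z)) 0 r = poissonIntegral u 0 R (ψ 0) := by
  obtain ⟨V, hV, hre⟩ := exists_differentiableOn_re_eq_poissonIntegral hu
  have hVψ : DifferentiableOn ℂ (V ∘ ψ) (closedBall 0 r) := hV.comp hψ hmap
  have hmean : circleAverage (V ∘ ψ) 0 r = V (ψ 0) := by
    refine DiffContOnCl.circleAverage (DifferentiableOn.diffContOnCl ?_)
    rw [abs_of_nonneg hr]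
    exact hVψ.mono closure_ball_subset_closedBall
  calc circleAverage (fun z => poissonIntegral u 0 R (ψ z)) 0 r
      = circleAverage (Complex.reCLM ∘ V ∘ ψ) 0 r := by
        refine circleAverage_congr_sphere fun z hz => (hre (hmap ?_)).symm
        exact sphere_subset_closedBall (abs_of_nonneg hr ▸ hz)
    _ = (V (ψ 0)).re := by
        rw [Complex.reCLM.circleAverage_comp_comm
          ((hVψ.continuousOn.mono sphere_subset_closedBall).circleIntegrable hr), hmean]
        rfl
    _ = poissonIntegral u 0 R (ψ 0) := hre (hmap (mem_closedBall_self hr))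

variable {E : Type*} [NormedAddCommGroup E] [NormedSpace ℂ E] [CompleteSpace E] {F : ℂ → E}
  {p M : ℝ}

theorem circleAverage_norm_comp_rpow_le_of_mapsTo (hp : 1 ≤ p) (hr : 0 ≤ r)
    (hF : DiffContOnCl ℂ F (ball 0 R)) (hψ : DifferentiableOn ℂ ψ (closedBall 0 r))
    (hmap : MapsTo ψ (closedBall 0 r) (ball 0 R)) :
    circleAverage (fun z => ‖F (ψ z)‖ ^ p) 0 r ≤
      (R + ‖ψ 0‖) / (R - ‖ψ 0‖) * circleAverage (fun z => ‖F z‖ ^ p) 0 R := by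
  have hψ0 : ψ 0 ∈ ball (0 : ℂ) R := hmap (mem_closedBall_self hr)
  have hnorm {g : ℂ → E} {s : Set ℂ} (hg : ContinuousOn g s) :
      ContinuousOn (fun z => ‖g z‖ ^ p) s := hg.norm.rpow_const fun _ _ => Or.inr (by linarith)
  have hu := hnorm (hF.continuousOn_ball.mono sphere_subset_closedBall)
  have huI := hu.circleIntegrable (pos_of_mem_ball hψ0).le
  have hψs := hψ.continuousOn.mono sphere_subset_closedBall
  have hmaps := hmap.mono_left sphere_subset_closedBall
  calc circleAverage (fun z => ‖F (ψ z)‖ ^ p) 0 r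
      ≤ circleAverage (fun z => poissonIntegral (fun z => ‖F z‖ ^ p) 0 R (ψ z)) 0 r :=
        circleAverage_mono
          ((hnorm (hF.continuousOn_ball.comp hψs
            (hmaps.mono_right ball_subset_closedBall))).circleIntegrable hr)
          (((continuousOn_poissonIntegral huI).comp hψs hmaps).circleIntegrable hr)
          fun z hz => norm_rpow_le_poissonIntegral hp hF (hmaps (abs_of_nonneg hr ▸ hz))
    _ = poissonIntegral (fun z => ‖F z‖ ^ p) 0 R (ψ 0) :=
        circleAverage_poissonIntegral_comp hr huI hψ hmap
    _ ≤ (R + ‖ψ 0‖) / (R - ‖ψ 0‖) * circleAverage (fun z => ‖F z‖ ^ p) 0 R := by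
        simpa only [sub_zero] using
          poissonIntegral_le_mul_circleAverage hψ0 hu fun z _ => by positivity

theorem circleAverage_norm_comp_rpow_le (hp : 1 ≤ p) (hF : DifferentiableOn ℂ F (ball 0 1))
    (hM : ∀ R ∈ Ioo (0 : ℝ) 1, circleAverage (fun z => ‖F z‖ ^ p) 0 R ≤ M)
    (hψ : DifferentiableOn ℂ ψ (ball 0 1)) (hmap : MapsTo ψ (ball 0 1) (ball 0 1))
    (hr : r ∈ Ico (0 : ℝ) 1) :
    circleAverage (fun z => ‖F (ψ z)‖ ^ p) 0 r ≤ (1 + ‖ψ 0‖) / (1 - ‖ψ 0‖) * M := by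
  have hsub : closedBall (0 : ℂ) r ⊆ ball 0 1 := closedBall_subset_ball hr.2
  have hψ0 : ‖ψ 0‖ < 1 := mem_ball_zero_iff.1 (hmap (mem_ball_self one_pos))
  obtain ⟨z₀, hz₀, hmax⟩ := (isCompact_closedBall (0 : ℂ) r).exists_isMaxOn
    (nonempty_closedBall.2 hr.1) (hψ.continuousOn.mono hsub).norm
  have hz₀1 : ‖ψ z₀‖ < 1 := mem_ball_zero_iff.1 (hmap (hsub hz₀))
  have hlim : Tendsto (fun R => (R + ‖ψ 0‖) / (R - ‖ψ 0‖) * M) (𝓝[<] 1)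
      (𝓝 ((1 + ‖ψ 0‖) / (1 - ‖ψ 0‖) * M)) := by
    refine (ContinuousAt.mul ?_ continuousAt_const).tendsto.mono_left nhdsWithin_le_nhds
    exact ContinuousAt.div (by fun_prop) (by fun_prop) (by linarith)
  refine ge_of_tendsto hlim ?_
  filter_upwards [Ioo_mem_nhdsLT hz₀1] with R hR
  have hmapR : MapsTo ψ (closedBall 0 r) (ball 0 R) := fun z hz =>
    mem_ball_zero_iff.2 ((hmax hz).trans_lt hR.1)
  have hψ0R : ‖ψ 0‖ < R := mem_ball_zero_iff.1 (hmapR (mem_closedBall_self hr.1))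
  have hR0 : 0 < R := (norm_nonneg _).trans_lt hψ0R
  have hFR : DiffContOnCl ℂ F (ball 0 R) := hF.diffContOnCl_ball (closedBall_subset_ball hR.2)
  refine (circleAverage_norm_comp_rpow_le_of_mapsTo hp hr.1 hFR (hψ.mono hsub) hmapR).trans ?_
  exact mul_le_mul_of_nonneg_left (hM R ⟨hR0, hR.2⟩)
    (div_nonneg (by positivity) (sub_nonneg.2 hψ0R.le))

theorem norm_rpow_le_of_circleAverage_le (hp : 1 ≤ p) (hF : DifferentiableOn ℂ F (ball 0 1))
    (hM : ∀ R ∈ Ioo (0 : ℝ) 1, circleAverage (fun z => ‖F z‖ ^ p) 0 R ≤ M) {w : ℂ}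
    (hw : w ∈ ball (0 : ℂ) 1) : ‖F w‖ ^ p ≤ (1 + ‖w‖) / (1 - ‖w‖) * M := by
  simpa only [circleAverage_const] using circleAverage_norm_comp_rpow_le hp hF hM
    (differentiableOn_const w) (fun _ _ => hw) (left_mem_Ico.2 one_pos)

end Subordination

section Primitive

variable {E : Type*} [NormedAddCommGroup E] [NormedSpace ℂ E] {F H : ℂ → E}

theorem norm_sub_le_two_pi_mul_circleAverage {c z w : ℂ} {R : ℝ} (hR : 0 ≤ R)
    (hH : ∀ ζ ∈ sphere c R, HasDerivAt H (F ζ) ζ) (hF : ContinuousOn F (sphere c R))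
    (hz : z ∈ sphere c R) (hw : w ∈ sphere c R) :
    ‖H z - H w‖ ≤ 2 * π * R * circleAverage (fun ζ => ‖F ζ‖) c R := by
  have hmem (θ : ℝ) : circleMap c R θ ∈ sphere c R := circleMap_mem_sphere c hR θ
  have hderiv (θ : ℝ) : HasDerivAt (fun θ => H (circleMap c R θ))
      ((circleMap 0 R θ * Complex.I) • F (circleMap c R θ)) θ :=
    (hH _ (hmem θ)).scomp θ (hasDerivAt_circleMap c R θ)
  have hcont : Continuous fun θ => R * ‖F (circleMap c R θ)‖ :=
    (hF.comp_continuous (continuous_circleMap c R) hmem).norm.const_mul R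
  have harc {a b : ℝ} (ha : 0 ≤ a) (hab : a ≤ b) (hb : b ≤ 2 * π) :
      ‖H (circleMap c R b) - H (circleMap c R a)‖ ≤
        2 * π * R * circleAverage (fun ζ => ‖F ζ‖) c R :=
    calc ‖H (circleMap c R b) - H (circleMap c R a)‖
        ≤ ∫ θ in a..b, R * ‖F (circleMap c R θ)‖ := by
          refine norm_sub_le_integral_of_norm_deriv_le_of_le hab
            (fun θ _ => (hderiv θ).continuousAt.continuousWithinAt)
            (fun θ _ => (hderiv θ).differentiableAt.differentiableWithinAt)
            (.of_forall fun θ _ => ?_) (hcont.intervalIntegrable a b)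
          simp [(hderiv θ).deriv, norm_smul, abs_of_nonneg hR]
      _ ≤ ∫ θ in (0 : ℝ)..2 * π, R * ‖F (circleMap c R θ)‖ :=
          intervalIntegral.integral_mono_interval ha hab hb
            (.of_forall fun θ => by positivity) (hcont.intervalIntegrable _ _)
      _ = 2 * π * R * circleAverage (fun ζ => ‖F ζ‖) c R := by
          rw [circleAverage_def, smul_eq_mul, intervalIntegral.integral_const_mul]
          field_simp
  rw [← abs_of_nonneg hR, ← image_circleMap_Ioc] at hz hw
  obtain ⟨a, ha, rfl⟩ := hz
  obtain ⟨b, hb, rfl⟩ := hw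
  rcases le_total a b with hab | hba
  · rw [norm_sub_rev]
    exact harc ha.1.le hab hb.2
  · exact harc hb.1.le hba ha.2

variable [CompleteSpace E]

theorem norm_primitive_sub_le {M : ℝ} (hH : ∀ z ∈ ball (0 : ℂ) 1, HasDerivAt H (F z) z)
    (hM : ∀ R ∈ Ioo (0 : ℝ) 1, circleAverage (fun z => ‖F z‖) 0 R ≤ M) {z : ℂ}
    (hz : z ∈ ball (0 : ℂ) 1) : ‖H z - H 0‖ ≤ 2 * π * M := by
  have hM0 : 0 ≤ M := (circleAverage_nonneg_of_nonneg fun z _ => norm_nonneg _).trans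
    (hM (1 / 2) (by norm_num))
  rcases eq_or_ne z 0 with rfl | hz0
  · simp only [sub_self, norm_zero]
    positivity
  have hr0 : 0 < ‖z‖ := norm_pos_iff.2 hz0
  have hr1 : ‖z‖ < 1 := mem_ball_zero_iff.1 hz
  have hsphere : sphere (0 : ℂ) ‖z‖ ⊆ ball 0 1 := sphere_subset_ball hr1
  have hHdiff : DifferentiableOn ℂ H (ball 0 1) := fun ζ hζ =>
    (hH ζ hζ).differentiableAt.differentiableWithinAt
  have hFcont : ContinuousOn F (ball 0 1) :=
    (hHdiff.deriv isOpen_ball).continuousOn.congr fun ζ hζ => (hH ζ hζ).deriv.symm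
  have hcircle (ζ : ℂ) (hζ : ζ ∈ sphere (0 : ℂ) ‖z‖) : ‖H z - H ζ‖ ≤ 2 * π * M :=
    calc ‖H z - H ζ‖ ≤ 2 * π * ‖z‖ * circleAverage (fun ζ => ‖F ζ‖) 0 ‖z‖ :=
          norm_sub_le_two_pi_mul_circleAverage hr0.le (fun ζ hζ => hH ζ (hsphere hζ))
            (hFcont.mono hsphere) (by simp) hζ
      _ ≤ 2 * π * 1 * M := by
          gcongr
          · exact circleAverage_nonneg_of_nonneg fun _ _ => norm_nonneg _
          · exact hM ‖z‖ ⟨hr0, hr1⟩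
      _ = 2 * π * M := by rw [mul_one]
  have hHcl : DiffContOnCl ℂ H (ball 0 ‖z‖) :=
    hHdiff.diffContOnCl_ball (closedBall_subset_ball hr1)
  exact Complex.norm_le_of_forall_mem_frontier_norm_le isBounded_ball
    (diffContOnCl_const.sub hHcl) (fun ζ hζ => hcircle ζ (frontier_ball_subset_sphere hζ))
    (subset_closure (mem_ball_self hr0))

end Primitive

section HardySpace

variable {p : ℝ} {f : 𝔻 → ℂ} {φ : 𝔻 → 𝔻}

theorem coe_mem_ball (z : 𝔻) : (z : ℂ) ∈ ball (0 : ℂ) 1 :=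
  mem_ball_zero_iff.2 z.norm_lt_one

theorem mapsTo_ext_coe (φ : 𝔻 → 𝔻) : MapsTo (ext fun w => (φ w : ℂ)) (ball 0 1) (ball 0 1) := by
  intro z hz
  lift z to 𝔻 using mem_ball_zero_iff.1 hz
  rw [ext_coe]
  exact coe_mem_ball _

theorem eqOn_ext_comp (f : 𝔻 → ℂ) (φ : 𝔻 → 𝔻) :
    EqOn (ext fun w => f (φ w)) (ext f ∘ ext fun w => (φ w : ℂ)) (ball 0 1) := by
  intro z hz
  lift z to 𝔻 using mem_ball_zero_iff.1 hz
  rw [Function.comp_apply, ext_coe, ext_coe, ext_coe]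

theorem MemHp.mean_le_hpNorm_rpow (hp : 1 ≤ p) (hf : MemHp p f) {r : ℝ} (hr : r ∈ Ioo (0 : ℝ) 1) :
    mean p f r ≤ hpNorm p f ^ p :=
  mean_le_of_rpow_le hp (hf.mean_le hp hr)

theorem hpNorm_le_of_mean_le {C : ℝ} (h : ∀ r ∈ Ioo (0 : ℝ) 1, mean p f r ≤ C) (hp : 0 ≤ p) :
    hpNorm p f ≤ C ^ (1 / p) := by
  have : Nonempty (Ioo (0 : ℝ) 1) := nonempty_Ioo_subtype one_pos
  exact rpow_le_rpow (iSup_nonneg fun _ => mean_nonneg _ _ _) (ciSup_le fun r => h r r.2)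
    (one_div_nonneg.2 hp)

theorem MemHp.one (p : ℝ) : MemHp p 1 := by
  have hone : EqOn (ext 1) (fun _ => 1) (ball 0 1) := by
    intro z hz
    lift z to 𝔻 using mem_ball_zero_iff.1 hz
    exact ext_coe 1 z
  refine ⟨(differentiableOn_const 1).congr hone, 1, ?_⟩
  rintro _ ⟨⟨r, hr⟩, rfl⟩
  refine (circleAverage_const_on_circle fun z hz => ?_).le
  rw [abs_of_pos hr.1] at hz
  simp [hone (sphere_subset_ball hr.2 hz)]

theorem MemHp.norm_le (hp : 1 ≤ p) (hf : MemHp p f) (z : 𝔻) :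
    ‖f z‖ ≤ ((1 + ‖(z : ℂ)‖) / (1 - ‖(z : ℂ)‖)) ^ (1 / p) * hpNorm p f := by
  have hp0 : 0 < p := by linarith
  have hz : 0 < 1 - ‖(z : ℂ)‖ := sub_pos.2 z.norm_lt_one
  have hnorm := hpNorm_nonneg p f
  have hpow := norm_rpow_le_of_circleAverage_le hp hf.1
    (fun R hR => hf.mean_le_hpNorm_rpow hp hR) (coe_mem_ball z)
  rwa [ext_coe, ← rpow_le_rpow_iff (by positivity) (by positivity) (one_div_pos.2 hp0),
    mul_rpow (by positivity) (by positivity), ← rpow_mul (norm_nonneg _), ← rpow_mul hnorm,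
    mul_one_div_cancel hp0.ne', rpow_one, rpow_one] at hpow

theorem MemHp.norm_le_of_norm_le (hp : 1 ≤ p) (hf : MemHp p f) {ρ : ℝ} (hρ : ρ < 1) {z : 𝔻}
    (hz : ‖(z : ℂ)‖ ≤ ρ) : ‖f z‖ ≤ ((1 + ρ) / (1 - ρ)) ^ (1 / p) * hpNorm p f := by
  have : 0 ≤ 1 / p := by positivity
  have : 0 ≤ ρ := (norm_nonneg _).trans hz
  have : 0 < 1 - ρ := sub_pos.2 hρ
  have : 0 < 1 - ‖(z : ℂ)‖ := sub_pos.2 z.norm_lt_one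
  refine (hf.norm_le hp z).trans (mul_le_mul_of_nonneg_right ?_ (hpNorm_nonneg p f))
  gcongr

theorem IsHol.circleAverage_norm_le_one_add_mean (hp : 1 ≤ p) (hf : IsHol f) {r : ℝ}
    (hr : r ∈ Ioo (0 : ℝ) 1) : circleAverage (fun z => ‖ext f z‖) 0 r ≤ 1 + mean p f r := by
  have hcont : ContinuousOn (fun z => ‖ext f z‖) (sphere 0 |r|) := by
    rw [abs_of_pos hr.1]
    exact (hf.continuousOn.mono (sphere_subset_ball hr.2)).norm
  have hcontp : ContinuousOn (fun z => ‖ext f z‖ ^ p) (sphere 0 |r|) :=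
    hcont.rpow_const fun _ _ => Or.inr (by linarith)
  have hpow {t : ℝ} (ht : 0 ≤ t) : t ≤ 1 + t ^ p := by
    rcases le_total t 1 with h | h
    · linarith [rpow_nonneg ht p]
    · linarith [self_le_rpow_of_one_le h hp]
  calc circleAverage (fun z => ‖ext f z‖) 0 r
      ≤ circleAverage (fun z => 1 + ‖ext f z‖ ^ p) 0 r :=
        circleAverage_mono hcont.circleIntegrable'
          (continuousOn_const.fun_add hcontp).circleIntegrable' fun z _ => hpow (norm_nonneg _)
    _ = 1 + mean p f r := by
        rw [circleAverage_fun_add (circleIntegrable_const _ _ _) hcontp.circleIntegrable',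
          circleAverage_const, mean]

theorem MemHp.exists_bounded_primitive (hp : 1 ≤ p) (hf : MemHp p f) :
    ∃ (H : ℂ → ℂ) (B : ℝ), (∀ z ∈ ball (0 : ℂ) 1, HasDerivAt H (ext f z) z) ∧
      ∀ z ∈ ball (0 : ℂ) 1, ‖H z‖ ≤ B := by
  obtain ⟨H, hH0, hH⟩ := hf.1.isExactOn_ball.with_val_at 0 0
  refine ⟨H, 2 * π * (1 + hpNorm p f ^ p), hH, fun z hz => ?_⟩
  have hbound := norm_primitive_sub_le hH (fun R hR =>
    (hf.1.circleAverage_norm_le_one_add_mean hp hR).trans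
      (add_le_add_right (hf.mean_le_hpNorm_rpow hp hR) 1)) hz
  rwa [hH0, sub_zero] at hbound

end HardySpace

section CompositionOperator

variable {p : ℝ} {f : 𝔻 → ℂ} {φ : 𝔻 → 𝔻}

theorem mean_comp_le (hp : 1 ≤ p) (hφ : IsHol fun z => (φ z : ℂ)) (hf : MemHp p f) {r : ℝ}
    (hr : r ∈ Ioo (0 : ℝ) 1) :
    mean p (fun z => f (φ z)) r ≤
      (1 + ‖(φ 0 : ℂ)‖) / (1 - ‖(φ 0 : ℂ)‖) * hpNorm p f ^ p := by
  have h0 : ext (fun w => (φ w : ℂ)) 0 = φ 0 := ext_coe _ 0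
  have hlittlewood := circleAverage_norm_comp_rpow_le hp hf.1
    (fun R hR => hf.mean_le_hpNorm_rpow hp hR) hφ (mapsTo_ext_coe φ) (Ioo_subset_Ico_self hr)
  rw [h0] at hlittlewood
  refine le_of_eq_of_le (circleAverage_congr_sphere fun z hz => ?_) hlittlewood
  rw [abs_of_pos hr.1] at hz
  rw [eqOn_ext_comp f φ (sphere_subset_ball hr.2 hz), Function.comp_apply]

theorem MemHp.comp (hp : 1 ≤ p) (hφ : IsHol fun z => (φ z : ℂ)) (hf : MemHp p f) :
    MemHp p fun z => f (φ z) := by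
  refine ⟨(hf.1.comp hφ (mapsTo_ext_coe φ)).congr (eqOn_ext_comp f φ),
    (1 + ‖(φ 0 : ℂ)‖) / (1 - ‖(φ 0 : ℂ)‖) * hpNorm p f ^ p, ?_⟩
  rintro _ ⟨r, rfl⟩
  exact mean_comp_le hp hφ hf r.2

theorem hpNorm_comp_le (hp : 1 ≤ p) (hφ : IsHol fun z => (φ z : ℂ)) (hf : MemHp p f) :
    hpNorm p (fun z => f (φ z)) ≤
      ((1 + ‖(φ 0 : ℂ)‖) / (1 - ‖(φ 0 : ℂ)‖)) ^ (1 / p) * hpNorm p f := by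
  have h0 : 0 < 1 - ‖(φ 0 : ℂ)‖ := sub_pos.2 (φ 0).norm_lt_one
  have hnorm := hpNorm_nonneg p f
  refine (hpNorm_le_of_mean_le (fun r hr => mean_comp_le hp hφ hf hr) (by linarith)).trans_eq ?_
  rw [mul_rpow (by positivity) (by positivity), ← rpow_mul hnorm,
    mul_one_div_cancel (by linarith), rpow_one]

variable (p) [hp : Fact (1 ≤ p)]

/-- The composition operator `C_φ f = f ∘ φ` on the Hardy space `H^p(𝔻)`, for a holomorphic
self-map `φ` of the disc. -/
noncomputable def compHp (hφ : IsHol fun z => (φ z : ℂ)) : Hp p →L[ℂ] Hp p :=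
  LinearMap.mkContinuous
    { toFun := fun f => ⟨fun z => f.1 (φ z), f.2.comp hp.out hφ⟩
      map_add' := fun _ _ => rfl
      map_smul' := fun _ _ => rfl }
    (((1 + ‖(φ 0 : ℂ)‖) / (1 - ‖(φ 0 : ℂ)‖)) ^ (1 / p)) fun f => hpNorm_comp_le hp.out hφ f.2

variable {p}

theorem compHp_apply (hφ : IsHol fun z => (φ z : ℂ)) (f : Hp p) (z : 𝔻) :
    compHp p hφ f z = f (φ z) :=
  rfl

theorem compHp_pow_apply (hφ : IsHol fun z => (φ z : ℂ)) (n : ℕ) (f : Hp p) (z : 𝔻) :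
    (compHp p hφ ^ n) f z = f (φ^[n] z) := by
  induction n generalizing f with
  | zero => rfl
  | succ n ih => rw [pow_succ, mul_apply_eq_comp, ih, compHp_apply, Function.iterate_succ_apply']

end CompositionOperator

section Divergence

variable {E : Type*} [NormedAddCommGroup E] [NormedSpace ℝ E] {h : ℕ → E} {c : E}

theorem not_bounded_of_increment_isBigO (hc : c ≠ 0)
    (hinc : (fun n : ℕ => h (n + 1) - h n - (n : ℝ)⁻¹ • c) =O[atTop] fun n => ((n : ℝ) ^ 2)⁻¹)
    (B : ℝ) : ¬ ∀ n, ‖h n‖ ≤ B := by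
  intro hB
  set a : ℕ → E := fun n => h (n + 1) - h n - (n : ℝ)⁻¹ • c
  have ha : Summable fun n => ‖a n‖ :=
    summable_of_isBigO_nat (Real.summable_nat_pow_inv.2 one_lt_two) hinc.norm_left
  have htelescope (N : ℕ) :
      (∑ n ∈ Finset.range N, (n : ℝ)⁻¹) • c = h N - h 0 - ∑ n ∈ Finset.range N, a n := by
    rw [Finset.sum_sub_distrib, Finset.sum_range_sub, sub_sub_cancel, Finset.sum_smul]
  refine Real.not_summable_natCast_inv (summable_of_sum_range_le
    (c := (B + B + ∑' n, ‖a n‖) / ‖c‖) (fun n => by positivity) fun N => ?_)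
  rw [le_div_iff₀ (norm_pos_iff.2 hc)]
  calc (∑ n ∈ Finset.range N, (n : ℝ)⁻¹) * ‖c‖
      = ‖(∑ n ∈ Finset.range N, (n : ℝ)⁻¹) • c‖ := by
        rw [norm_smul, norm_of_nonneg (Finset.sum_nonneg fun n _ => by positivity)]
    _ ≤ ‖h N‖ + ‖h 0‖ + ‖∑ n ∈ Finset.range N, a n‖ := by
        rw [htelescope]
        exact (norm_sub_le _ _).trans (add_le_add_left (norm_sub_le _ _) _)
    _ ≤ B + B + ∑' n, ‖a n‖ := by
        gcongr
        · exact hB N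
        · exact hB 0
        · exact (norm_sum_le _ _).trans (ha.sum_le_tsum _ fun n _ => norm_nonneg _)

end Divergence

section FixedPoint

open scoped OnePoint

variable {K : Type*} [Field K] [DecidableEq K] {g : GL (Fin 2) K}

theorem exists_smul_coe_eq_coe_add (hg : ∀ w : OnePoint K, g • w = w ↔ w = ∞) :
    ∃ t ≠ 0, ∀ z : K, g • (z : OnePoint K) = ((z + t : K) : OnePoint K) := by
  have hc : g 1 0 = 0 := OnePoint.smul_infty_eq_self_iff.1 ((hg ∞).2 rfl)
  have hdet : g 0 0 * g 1 1 ≠ 0 := by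
    simpa [Matrix.det_fin_two, hc] using g.det_ne_zero
  have hd : g 1 1 ≠ 0 := right_ne_zero_of_mul hdet
  have hsmul (z : K) :
      g • (z : OnePoint K) = ((g 0 0 * z + g 0 1) / g 1 1 : K) := by
    simp [OnePoint.smul_some_eq_ite, hc, hd]
  have hfix (z : K) : g 0 0 * z + g 0 1 ≠ z * g 1 1 := by
    rw [Ne, ← div_eq_iff hd, ← OnePoint.coe_eq_coe, ← hsmul, hg]
    exact OnePoint.coe_ne_infty z
  have had : g 0 0 = g 1 1 := by
    by_contra had
    have hsub : g 1 1 - g 0 0 ≠ 0 := sub_ne_zero.2 (Ne.symm had)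
    refine hfix (g 0 1 / (g 1 1 - g 0 0)) ?_
    field_simp
    ring
  have hb : g 0 1 ≠ 0 := by simpa using hfix 0
  refine ⟨g 0 1 / g 1 1, div_ne_zero hb hd, fun z => ?_⟩
  rw [hsmul, had, add_div, mul_div_cancel_left₀ _ hd]

/-- The linear fractional map `z ↦ (z - α)⁻¹`, which moves `α` to `∞`. -/
def invSub (α : K) : GL (Fin 2) K :=
  Matrix.GeneralLinearGroup.mkOfDetNeZero !![0, 1; 1, -α] (by simp)

theorem invSub_smul_coe_self (α : K) : invSub α • (α : OnePoint K) = ∞ := by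
  simp [OnePoint.smul_some_eq_ite, invSub, Matrix.GeneralLinearGroup.mkOfDetNeZero]

theorem invSub_smul_coe_of_ne {α z : K} (hz : z ≠ α) :
    invSub α • (z : OnePoint K) = ((z - α)⁻¹ : K) := by
  simp [OnePoint.smul_some_eq_ite, invSub, Matrix.GeneralLinearGroup.mkOfDetNeZero,
    ← sub_eq_add_neg, sub_ne_zero.2 hz]

theorem exists_inv_sub_eq_add_of_smul_coe_eq_coe {α : K}
    (hg : ∀ w : OnePoint K, g • w = w ↔ w = α) :
    ∃ t ≠ 0, ∀ z w : K, z ≠ α → g • (z : OnePoint K) = w →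
      w ≠ α ∧ (w - α)⁻¹ = t + (z - α)⁻¹ := by
  set σ := invSub α
  have hσ : σ⁻¹ • (∞ : OnePoint K) = α := inv_smul_eq_iff.2 (invSub_smul_coe_self α).symm
  have hconj (w : OnePoint K) : (σ * g * σ⁻¹) • w = w ↔ w = ∞ := by
    rw [mul_smul, mul_smul, ← eq_inv_smul_iff, hg, ← hσ, smul_left_cancel_iff]
  obtain ⟨t, ht0, ht⟩ := exists_smul_coe_eq_coe_add hconj
  refine ⟨t, ht0, fun z w hz hw => ?_⟩
  have hσw : σ • (w : OnePoint K) = (((z - α)⁻¹ + t : K) : OnePoint K) := by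
    rw [← ht, ← invSub_smul_coe_of_ne hz, mul_smul, mul_smul, inv_smul_smul, hw]
  have hwα : w ≠ α := by
    rintro rfl
    rw [invSub_smul_coe_self] at hσw
    exact OnePoint.infty_ne_coe _ hσw
  rw [invSub_smul_coe_of_ne hwα, OnePoint.coe_eq_coe] at hσw
  exact ⟨hwα, hσw.trans (add_comm _ _)⟩

end FixedPoint

section ConjTranslation

variable {φ : 𝔻 → 𝔻} {α s t : ℂ}

theorem eq_zero_of_coe_eq_add (hφ : ∀ z : 𝔻, (φ z : ℂ) = z + t) : t = 0 := by
  have hiterate (n : ℕ) : (φ^[n] 0 : ℂ) = n * t := by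
    induction n with
    | zero => simp
    | succ n ih =>
      rw [Function.iterate_succ_apply', hφ, ih]
      push_cast
      ring
  by_contra ht
  obtain ⟨n, hn⟩ := exists_nat_gt ‖t‖⁻¹
  have hlt := (φ^[n] 0).norm_lt_one
  rw [hiterate, norm_mul, Complex.norm_natCast] at hlt
  rw [inv_lt_iff_one_lt_mul₀ (norm_pos_iff.2 ht)] at hn
  linarith

/-- `φ` is conjugate, through `z ↦ (z - α)⁻¹`, to the translation by `s`: the normal form of a
parabolic map with the finite fixed point `α`. -/
def IsConjTranslation (φ : 𝔻 → 𝔻) (α s : ℂ) : Prop :=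
  ∀ z : 𝔻, (z : ℂ) ≠ α → (φ z : ℂ) ≠ α ∧ ((φ z : ℂ) - α)⁻¹ = s + ((z : ℂ) - α)⁻¹

namespace IsConjTranslation

theorem iterate (h : IsConjTranslation φ α s) (n : ℕ) : IsConjTranslation (φ^[n]) α (n * s) := by
  intro z hz
  induction n with
  | zero => simpa using hz
  | succ n ih =>
    obtain ⟨hne, hinv⟩ := h _ ih.1
    rw [Function.iterate_succ_apply']
    refine ⟨hne, ?_⟩
    rw [hinv, ih.2]
    push_cast
    ring

/-- If `α` were in the disc, the points `α - (n s)⁻¹`, which `φ^[n]` maps to `∞`, would enter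
the disc. -/
theorem one_le_norm (h : IsConjTranslation φ α s) (hs : s ≠ 0) : 1 ≤ ‖α‖ := by
  by_contra! hα
  have hlim : Tendsto (fun n : ℕ => α - (n * s)⁻¹) atTop (𝓝 α) := by
    simpa [mul_comm] using
      ((tendsto_inv_atTop_nhds_zero_nat (𝕜 := ℂ)).mul_const s⁻¹).const_sub α
  obtain ⟨n, hn, hn0⟩ := ((hlim.eventually_mem (isOpen_ball.mem_nhds
    (mem_ball_zero_iff.2 hα))).and (eventually_ne_atTop 0)).exists
  let z : 𝔻 := .mk _ (mem_ball_zero_iff.1 hn)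
  have hz : (z : ℂ) = α - (n * s)⁻¹ := rfl
  obtain ⟨hne, hinv⟩ := h.iterate n z (by simp [hz, hs, hn0])
  rw [hz, sub_sub_cancel_left, inv_neg, inv_inv, add_neg_cancel, inv_eq_zero, sub_eq_zero] at hinv
  exact hne hinv

end IsConjTranslation

theorem IsParabolic.exists_isConjTranslation (hφ : IsParabolic φ) :
    ∃ α s : ℂ, s ≠ 0 ∧ IsConjTranslation φ α s := by
  obtain ⟨g, hg, w₀, hw₀, hunique⟩ := hφ
  have hfix (w : OnePoint ℂ) : g • w = w ↔ w = w₀ := ⟨hunique w, fun h => h ▸ hw₀⟩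
  induction w₀ with
  | infty =>
    obtain ⟨t, ht0, ht⟩ := exists_smul_coe_eq_coe_add hfix
    exact absurd (eq_zero_of_coe_eq_add fun z => OnePoint.coe_injective ((hg z).trans (ht z))) ht0
  | coe α =>
    obtain ⟨s, hs0, hs⟩ := exists_inv_sub_eq_add_of_smul_coe_eq_coe hfix
    exact ⟨α, s, hs0, fun z hz => hs z (φ z) hz (hg z).symm⟩

end ConjTranslation

section InvNatCast

variable {𝕜 : Type*} [RCLike 𝕜] {s : 𝕜}

theorem natCast_isBigO_natCast_mul_add (hs : s ≠ 0) (u : 𝕜) :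
    (fun n : ℕ => (n : ℝ)) =O[atTop] fun n => (n : 𝕜) * s + u := by
  have hmul : (fun n : ℕ => (n : ℝ)) =O[atTop] fun n => (n : 𝕜) * s := by
    refine IsBigO.of_bound ‖s‖⁻¹ (.of_forall fun n => le_of_eq ?_)
    simp only [norm_mul, RCLike.norm_natCast]
    field_simp
  have hu : (fun _ : ℕ => u) =o[atTop] fun n => (n : ℝ) :=
    isLittleO_const_left.2 (Or.inr (tendsto_norm_atTop_atTop.comp tendsto_natCast_atTop_atTop))
  exact hmul.trans (hu.trans_isBigO hmul).right_isBigO_add'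

theorem isBigO_inv_natCast_mul_add (hs : s ≠ 0) (u : 𝕜) :
    (fun n : ℕ => ((n : 𝕜) * s + u)⁻¹) =O[atTop] fun n => (n : ℝ)⁻¹ := by
  refine (natCast_isBigO_natCast_mul_add hs u).inv_rev ?_
  filter_upwards [eventually_ne_atTop 0] with n hn h
  exact absurd (Nat.cast_eq_zero.1 h) hn

theorem eventually_natCast_mul_add_ne_zero (hs : s ≠ 0) (u : 𝕜) :
    ∀ᶠ n : ℕ in atTop, (n : 𝕜) * s + u ≠ 0 := by
  filter_upwards [(natCast_isBigO_natCast_mul_add hs u).eq_zero_imp, eventually_ne_atTop 0]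
    with n h hn h0
  exact hn (Nat.cast_eq_zero.1 (h h0))

theorem isBigO_natCast_mul_sub_inv_add (hs : s ≠ 0) (u : 𝕜) :
    (fun n : ℕ => (n : 𝕜) * (((n + 1 : ℕ) * s + u)⁻¹ - (n * s + u)⁻¹) + (s * n)⁻¹) =O[atTop]
      fun n => ((n : ℝ) ^ 2)⁻¹ := by
  have hx := isBigO_inv_natCast_mul_add hs u
  have hx' := isBigO_inv_natCast_mul_add hs (s + u)
  have hsn : (fun n : ℕ => ((n : 𝕜) * s)⁻¹) =O[atTop] fun n => (n : ℝ)⁻¹ := by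
    simpa only [add_zero] using isBigO_inv_natCast_mul_add hs 0
  have hmain := ((hx'.mul hsn).const_mul_left (s + u)).add ((hx.mul hx').const_mul_left u)
  refine hmain.congr' ?_ (.of_forall fun n => by simp only [sq, mul_inv])
  filter_upwards [eventually_natCast_mul_add_ne_zero hs u,
    eventually_natCast_mul_add_ne_zero hs (s + u), eventually_ne_atTop 0] with n h h' hn
  have hn' : (n : 𝕜) ≠ 0 := Nat.cast_ne_zero.2 hn
  rw [Nat.cast_succ, add_one_mul, add_assoc]
  rw [mul_comm (n : 𝕜)] at h h'
  field_simp
  ring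

end InvNatCast

section PrimitiveAlongOrbits

variable {φ : 𝔻 → 𝔻} {α s t z κ : ℂ} {F H : ℂ → ℂ} {ρ K : ℝ}

/-- The linear fractional map that `z ↦ (z - α)⁻¹` conjugates to the translation by `t`. -/
noncomputable def conjTranslation (α t z : ℂ) : ℂ := α + (t + (z - α)⁻¹)⁻¹

theorem hasDerivAt_conjTranslation (hz : z ≠ α) (ht : t + (z - α)⁻¹ ≠ 0) :
    HasDerivAt (conjTranslation α t) ((1 + t * (z - α)) ^ 2)⁻¹ z := by
  have hz' : z - α ≠ 0 := sub_ne_zero.2 hz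
  have hderiv :=
    (((((hasDerivAt_id z).sub_const α).fun_inv hz').const_add t).fun_inv ht).const_add α
  refine hderiv.congr_deriv ?_
  have hfactor : 1 + t * (z - α) = (z - α) * (t + (z - α)⁻¹) := by
    rw [mul_add, mul_inv_cancel₀ hz']
    ring
  rw [hfactor, mul_pow, mul_inv, id]
  ring

theorem norm_inv_one_add_mul_sub_sq_le (hα : 1 ≤ ‖α‖) (hz : ‖z‖ ≤ ρ)
    (ht : 2 ≤ ‖t‖ * (1 - ρ)) : ‖((1 + t * (z - α)) ^ 2)⁻¹‖ ≤ 4 / (‖t‖ * (1 - ρ)) ^ 2 := by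
  have hdist : 1 - ρ ≤ ‖z - α‖ := by
    linarith [norm_sub_norm_le α z, norm_sub_rev α z]
  have hlower : ‖t‖ * (1 - ρ) / 2 ≤ ‖1 + t * (z - α)‖ := by
    have htriangle := norm_sub_le_norm_add (t * (z - α)) 1
    rw [norm_mul, norm_one, add_comm (t * (z - α))] at htriangle
    linarith [mul_le_mul_of_nonneg_left hdist (norm_nonneg t)]
  calc ‖((1 + t * (z - α)) ^ 2)⁻¹‖ = (‖1 + t * (z - α)‖ ^ 2)⁻¹ := by rw [norm_inv, norm_pow]
    _ ≤ ((‖t‖ * (1 - ρ) / 2) ^ 2)⁻¹ := by gcongr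
    _ = 4 / (‖t‖ * (1 - ρ)) ^ 2 := by
      rw [div_pow, inv_div]
      norm_num

theorem coe_ne_of_one_le_norm (hα : 1 ≤ ‖α‖) (z : 𝔻) : (z : ℂ) ≠ α := by
  rintro rfl
  exact hα.not_gt z.norm_lt_one

namespace IsConjTranslation

theorem add_inv_ne_zero (h : IsConjTranslation φ α t) (hα : 1 ≤ ‖α‖) (z : 𝔻) :
    t + ((z : ℂ) - α)⁻¹ ≠ 0 := by
  obtain ⟨hne, hinv⟩ := h z (coe_ne_of_one_le_norm hα z)
  exact hinv ▸ inv_ne_zero (sub_ne_zero.2 hne)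

theorem coe_eq (h : IsConjTranslation φ α t) (hα : 1 ≤ ‖α‖) (z : 𝔻) :
    (φ z : ℂ) = conjTranslation α t z := by
  rw [conjTranslation, ← (h z (coe_ne_of_one_le_norm hα z)).2, inv_inv, add_sub_cancel]

theorem hasDerivAt (h : IsConjTranslation φ α t) (hα : 1 ≤ ‖α‖) (z : 𝔻) :
    HasDerivAt (conjTranslation α t) ((1 + t * (z - α)) ^ 2)⁻¹ z :=
  hasDerivAt_conjTranslation (coe_ne_of_one_le_norm hα z) (h.add_inv_ne_zero hα z)

theorem isHol (h : IsConjTranslation φ α t) (hα : 1 ≤ ‖α‖) : IsHol fun z => (φ z : ℂ) := by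
  have hdiff : DifferentiableOn ℂ (conjTranslation α t) (ball 0 1) := fun z hz => by
    lift z to 𝔻 using mem_ball_zero_iff.1 hz
    exact (h.hasDerivAt hα z).differentiableAt.differentiableWithinAt
  refine hdiff.congr fun z hz => ?_
  lift z to 𝔻 using mem_ball_zero_iff.1 hz
  rw [ext_coe, h.coe_eq hα]

theorem norm_comp_sub_comp_le (h : IsConjTranslation φ α t)
    (hH : ∀ z ∈ ball (0 : ℂ) 1, HasDerivAt H (F z) z) (ht : 2 ≤ ‖t‖ * (1 - ρ))
    (hF : ∀ z : 𝔻, ‖(z : ℂ)‖ ≤ ρ → ‖F (φ z)‖ ≤ K) {z w : 𝔻} (hz : ‖(z : ℂ)‖ ≤ ρ)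
    (hw : ‖(w : ℂ)‖ ≤ ρ) :
    ‖H (φ z) - H (φ w)‖ ≤ K * (4 / (‖t‖ * (1 - ρ)) ^ 2) * ‖(z : ℂ) - w‖ := by
  have hα : 1 ≤ ‖α‖ := h.one_le_norm fun ht0 => by norm_num [ht0] at ht
  have hρ : ρ < 1 := sub_pos.1 (pos_of_mul_pos_right (two_pos.trans_le ht) (norm_nonneg t))
  have hK : 0 ≤ K := (norm_nonneg _).trans (hF z hz)
  have hderiv (v : ℂ) (hv : v ∈ closedBall (0 : ℂ) ρ) : HasDerivWithinAt
      (H ∘ conjTranslation α t) (F (conjTranslation α t v) * ((1 + t * (v - α)) ^ 2)⁻¹)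
      (closedBall 0 ρ) v := by
    lift v to 𝔻 using mem_ball_zero_iff.1 (closedBall_subset_ball hρ hv)
    have hHφ := hH _ (coe_mem_ball (φ v))
    rw [h.coe_eq hα] at hHφ
    exact (hHφ.comp _ (h.hasDerivAt hα v)).hasDerivWithinAt
  have hbound (v : ℂ) (hv : v ∈ closedBall (0 : ℂ) ρ) :
      ‖F (conjTranslation α t v) * ((1 + t * (v - α)) ^ 2)⁻¹‖ ≤
        K * (4 / (‖t‖ * (1 - ρ)) ^ 2) := by
    lift v to 𝔻 using mem_ball_zero_iff.1 (closedBall_subset_ball hρ hv)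
    have hvρ := mem_closedBall_zero_iff.1 hv
    rw [norm_mul, ← h.coe_eq hα]
    exact mul_le_mul (hF v hvρ) (norm_inv_one_add_mul_sub_sq_le hα hvρ ht) (norm_nonneg _) hK
  simpa only [Function.comp_apply, ← h.coe_eq hα] using
    (convex_closedBall (0 : ℂ) ρ).norm_image_sub_le_of_norm_hasDerivWithin_le hderiv hbound
      (mem_closedBall_zero_iff.2 hw) (mem_closedBall_zero_iff.2 hz)

theorem isBigO_natCast_mul_iterate_sub (h : IsConjTranslation φ α s) (hs : s ≠ 0) (z : 𝔻) :
    (fun n : ℕ => (n : ℂ) * ((φ^[n + 1] z : ℂ) - φ^[n] z) + (s * n)⁻¹) =O[atTop]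
      fun n => ((n : ℝ) ^ 2)⁻¹ := by
  simpa only [(h.iterate _).coe_eq (h.one_le_norm hs), conjTranslation,
    add_sub_add_left_eq_sub] using isBigO_natCast_mul_sub_inv_add hs ((z : ℂ) - α)⁻¹

/-- Removing the linear part `n κ z` of the primitive leaves a bounded derivative along the
`n`-th iterate, whose own derivative is `O(1 / n ^ 2)`. -/
theorem isBigO_primitive_iterate_sub (h : IsConjTranslation φ α s) (hs : s ≠ 0)
    (hH : ∀ z ∈ ball (0 : ℂ) 1, HasDerivAt H (F z) z) (hρ : ρ < 1)
    (hF : ∀ n : ℕ, 1 ≤ n → ∀ z : 𝔻, ‖(z : ℂ)‖ ≤ ρ → ‖F (φ^[n] z) - n * κ‖ ≤ K) {z : 𝔻}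
    (hz : ‖(z : ℂ)‖ ≤ ρ) (hφz : ‖(φ z : ℂ)‖ ≤ ρ) :
    (fun n : ℕ => H (φ^[n + 1] z) - H (φ^[n] z) -
      n * κ * ((φ^[n + 1] z : ℂ) - φ^[n] z)) =O[atTop] fun n => ((n : ℝ) ^ 2)⁻¹ := by
  have hlarge : ∀ᶠ n : ℕ in atTop, 2 ≤ ‖(n * s : ℂ)‖ * (1 - ρ) := by
    have htendsto : Tendsto (fun n : ℕ => (n : ℝ) * (‖s‖ * (1 - ρ))) atTop atTop :=
      tendsto_natCast_atTop_atTop.atTop_mul_const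
        (mul_pos (norm_pos_iff.2 hs) (sub_pos.2 hρ))
    simpa only [norm_mul, Complex.norm_natCast, mul_assoc] using htendsto.eventually_ge_atTop 2
  refine IsBigO.of_bound (K * (4 / (‖s‖ * (1 - ρ)) ^ 2) * ‖(φ z : ℂ) - z‖) ?_
  filter_upwards [hlarge, eventually_ge_atTop 1] with n hn hn1
  have hderiv (v : ℂ) (hv : v ∈ ball (0 : ℂ) 1) :
      HasDerivAt (fun v => H v - n * κ * v) (F v - n * κ) v := by
    simpa using (hH v hv).fun_sub ((hasDerivAt_id v).const_mul (n * κ))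
  have hmain := (h.iterate n).norm_comp_sub_comp_le hderiv hn (hF n hn1) hφz hz
  rw [sub_sub_sub_comm, ← mul_sub, ← Function.iterate_succ_apply] at hmain
  refine hmain.trans_eq ?_
  simp only [norm_mul, Complex.norm_natCast, norm_inv, norm_pow, Real.norm_natCast]
  field_simp

theorem not_bounded_primitive (h : IsConjTranslation φ α s) (hs : s ≠ 0) (hκ : κ ≠ 0)
    (hH : ∀ z ∈ ball (0 : ℂ) 1, HasDerivAt H (F z) z)
    (hF : ∀ ρ < 1, ∃ K, ∀ n : ℕ, 1 ≤ n → ∀ z : 𝔻, ‖(z : ℂ)‖ ≤ ρ → ‖F (φ^[n] z) - n * κ‖ ≤ K)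
    (B : ℝ) : ¬ ∀ z ∈ ball (0 : ℂ) 1, ‖H z‖ ≤ B := by
  intro hB
  obtain ⟨K, hK⟩ := hF ‖(φ 0 : ℂ)‖ (φ 0).norm_lt_one
  have hH_inc := h.isBigO_primitive_iterate_sub hs hH (φ 0).norm_lt_one hK
    (z := 0) (by simp) le_rfl
  have horbit := (h.isBigO_natCast_mul_iterate_sub hs 0).const_mul_left κ
  refine not_bounded_of_increment_isBigO (h := fun n => H (φ^[n] 0)) (c := -(κ / s))
    (neg_ne_zero.2 (div_ne_zero hκ hs)) ((hH_inc.add horbit).congr_left fun n => ?_) B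
    fun n => hB _ (coe_mem_ball _)
  rw [Complex.real_smul, mul_inv, div_eq_mul_inv]
  push_cast
  ring

end IsConjTranslation

end PrimitiveAlongOrbits

section Shadowing

theorem PositiveShadowing.exists_norm_pow_sub_natCast_smul_le {X : Type*} [NormedAddCommGroup X]
    [NormedSpace ℂ X] {T : X →L[ℂ] X} (hT : PositiveShadowing T) {e : X} (he : T e = e) :
    ∃ κ : ℂ, κ ≠ 0 ∧ ∃ y, ∀ n : ℕ, 1 ≤ n → ‖(T ^ n) y - (n * κ) • e‖ ≤ 1 := by
  obtain ⟨δ, hδ, hshadow⟩ := hT 1 one_pos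
  have he_pos : 0 < ‖e‖ + 1 := by positivity
  set κ : ℂ := ((δ / (‖e‖ + 1) : ℝ) : ℂ)
  have hκ_norm : ‖κ‖ = δ / (‖e‖ + 1) := Complex.norm_of_nonneg (by positivity)
  have hκ : κ ≠ 0 := norm_pos_iff.1 (hκ_norm ▸ div_pos hδ he_pos)
  refine ⟨κ, hκ, hshadow (fun n => (n * κ) • e) fun n _ => ?_⟩
  calc ‖T ((n * κ) • e) - ((n + 1 : ℕ) * κ) • e‖ = ‖-(κ • e)‖ := by
        rw [map_smul, he, ← sub_smul, ← neg_smul]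
        push_cast
        ring_nf
    _ = δ / (‖e‖ + 1) * ‖e‖ := by rw [norm_neg, norm_smul, hκ_norm]
    _ ≤ δ := by
      rw [div_mul_eq_mul_div, div_le_iff₀ he_pos]
      linarith

variable {p : ℝ} {φ : 𝔻 → 𝔻} {α s : ℂ}

theorem IsConjTranslation.not_positiveShadowing [hp : Fact (1 ≤ p)]
    (h : IsConjTranslation φ α s) (hs : s ≠ 0) (hφ : IsHol fun z => (φ z : ℂ)) :
    ¬ PositiveShadowing (compHp p hφ) := by
  intro hshadow
  let one : Hp p := ⟨1, MemHp.one p⟩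
  obtain ⟨κ, hκ, y, hy⟩ := hshadow.exists_norm_pow_sub_natCast_smul_le (e := one) rfl
  obtain ⟨H, B, hH, hB⟩ := y.2.exists_bounded_primitive hp.out
  refine h.not_bounded_primitive hs hκ hH (fun ρ hρ => ?_) B hB
  refine ⟨((1 + ρ) / (1 - ρ)) ^ (1 / p), fun n hn z hz => ?_⟩
  have heval : ((compHp p hφ ^ n) y - (n * κ) • one) z = y (φ^[n] z) - n * κ := by
    rw [← compHp_pow_apply hφ]
    exact congrArg (((compHp p hφ ^ n) y : 𝔻 → ℂ) z - ·) (mul_one (n * κ))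
  rw [ext_coe, ← heval]
  have hK : 0 ≤ (1 + ρ) / (1 - ρ) :=
    div_nonneg (by linarith [norm_nonneg (z : ℂ)]) (sub_nonneg.2 hρ.le)
  exact (MemHp.norm_le_of_norm_le hp.out (Subtype.property _) hρ hz).trans
    (mul_le_of_le_one_right (rpow_nonneg hK _) (hy n hn))

end Shadowing

end HardyShadowing

theorem mainTheorem11 (p : ℝ) [Fact (1 ≤ p)] (φ : Complex.UnitDisc → Complex.UnitDisc)
    (hφ : HardyShadowing.IsParabolic φ) :
    ∃ T : HardyShadowing.Hp p →L[ℂ] HardyShadowing.Hp p,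
      (∀ (f : HardyShadowing.Hp p) (z : Complex.UnitDisc), T f z = f (φ z)) ∧
        ¬ HardyShadowing.PositiveShadowing T := by
  obtain ⟨α, s, hs, h⟩ := hφ.exists_isConjTranslation
  have hHol := h.isHol (h.one_le_norm hs)
  exact ⟨HardyShadowing.compHp p hHol, HardyShadowing.compHp_apply hHol,
    h.not_positiveShadowing hs hHol⟩
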